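/- All rings are commutative with $1$. For a ring extension $R \subseteq S$, let $[R,S]$ be the set of all $R$-subalgebras of $S$, ordered by inclusion. The extension is called FMC if there is a finite maximal chain of extensions from $R$ to $S$, that is, if the ordered set $[R,S]$ has a finite maximal chain. A ring extension $R \subseteq T$ has finite fibers if for every $P \in \operatorname{Spec}(R)$ the set $\{Q \in \operatorname{Spec}(T) \mid Q \cap R = P\}$ is finite. If $R \subseteq S$ is an FMC extension, then $R \subseteq T$ has finite fibers for every $T \in [R,S]$. -/

import Mathlib

/-- An `R`-algebra `S` (in applications a ring extension `R ⊆ S`) has FMC if the set `[R, S]` of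
its `R`-subalgebras, ordered by inclusion, has a finite maximal chain. By maximality such a chain
contains the least element `⊥` (the image of `R`) and the greatest element `⊤` (all of `S`). -/
def IsFMC (R S : Type*) [CommRing R] [CommRing S] [Algebra R S] : Prop :=
  ∃ C : Set (Subalgebra R S), C.Finite ∧ IsMaxChain (· ≤ ·) C

/-- The fiber at `P ∈ Spec R` of an `R`-algebra `T`: the set of all `Q ∈ Spec T` lying over `P`. -/
def primeFiber (R T : Type*) [CommRing R] [CommRing T] [Algebra R T] (P : PrimeSpectrum R) :
    Set (PrimeSpectrum T) :=
  {Q | PrimeSpectrum.comap (algebraMap R T) Q = P}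

/-- An `R`-algebra `T` has finite fibers if its fiber at every prime ideal of `R` is a finite
set. -/
def HasFiniteFibers (R T : Type*) [CommRing R] [CommRing T] [Algebra R T] : Prop :=
  ∀ P : PrimeSpectrum R, (primeFiber R T P).Finite

/-! Descend along the finite maximal chain: for each `A` in it and every `T ⊇ A`, the extension `A ⊆
T` has finite fibers and finite residue field extensions. The residue fields are needed because
their degrees bound later fibers.

For a cover `A ⋖ B`, the claim is known for `B ⊆ BT`. If `B` contains an element integral over `A`
outside `A`, then `A ⊆ B` is finite and `T ⊆ BT` is integral, so lying over gives the claim for `A ⊆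
T`. Otherwise `A` is integrally closed in `B`, and at each prime `P` every element of `B` is a
fraction or inverse fraction from `A`. Take `p` in `B` maximal among ideals avoiding `A \ P`. Each
prime of `T` over `P` contains `Q' ∩ T` for one of the finitely many `Q'` over `p`, and rank bounds
over `p` carry over to `P`, leaving finitely many primes for each `Q'`. -/

open Polynomial

/-- Finite fibers on spectra, and finite residue field extensions. -/
def RingHom.FiniteFibersAndResidueFields {A B : Type*} [CommRing A] [CommRing B]
    (f : A →+* B) : Prop :=
  (∀ P : PrimeSpectrum A, {Q | PrimeSpectrum.comap f Q = P}.Finite) ∧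
  ∀ (P : Ideal A) (Q : Ideal B) [P.IsPrime] [Q.IsPrime] (h : P = Q.comap f),
    (Ideal.ResidueField.map P Q f h).Finite

/-- Over a prime `P`, the quotient `B / J` has rank at most `n`: any `n + 1` elements of `B` satisfy
a linear relation modulo `J` with some coefficient outside `P`. -/
def RingHom.FiberRankLE {A B : Type*} [CommRing A] [CommRing B]
    (f : A →+* B) (P : Ideal A) (J : Ideal B) (n : ℕ) : Prop :=
  ∀ t : Fin (n + 1) → B, ∃ r : Fin (n + 1) → A, (∃ i, r i ∉ P) ∧ ∑ i, f (r i) * t i ∈ J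

/-! ### Finite fibers, residue degrees and rank bounds -/

section

variable {A B C : Type*} [CommRing A] [CommRing B] [CommRing C]

theorem Ideal.ResidueField.map_comp_eq (f : A →+* B) (g : B →+* C) {I : Ideal A} {J : Ideal B}
    {K : Ideal C} [I.IsPrime] [J.IsPrime] [K.IsPrime] (hI : I = J.comap f) (hJ : J = K.comap g)
    (hK : I = K.comap (g.comp f)) :
    Ideal.ResidueField.map I K (g.comp f) hK =
      (Ideal.ResidueField.map J K g hJ).comp (Ideal.ResidueField.map I J f hI) := by
  apply Ideal.ResidueField.ringHom_ext
  ext r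
  simp

theorem RingHom.FiniteFibersAndResidueFields.comp {f : A →+* B} {g : B →+* C}
    (hg : g.FiniteFibersAndResidueFields) (hf : f.FiniteFibersAndResidueFields) :
    (g.comp f).FiniteFibersAndResidueFields := by
  refine ⟨fun P ↦ ?_, fun P Q _ _ h ↦ ?_⟩
  · refine ((hf.1 P).biUnion fun Q _ ↦ hg.1 Q).subset fun Q hQ ↦ ?_
    simp only [Set.mem_iUnion, Set.mem_ofPred_eq]
    exact ⟨PrimeSpectrum.comap g Q, hQ, rfl⟩
  · rw [Ideal.ResidueField.map_comp_eq f g (J := Q.comap g) h rfl h]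
    exact (hg.2 _ _ _).comp (hf.2 _ _ _)

theorem RingHom.FiniteFibersAndResidueFields.of_comp {f : A →+* B} {g : B →+* C}
    (h : (g.comp f).FiniteFibersAndResidueFields)
    (hg : Function.Surjective (PrimeSpectrum.comap g)) :
    f.FiniteFibersAndResidueFields := by
  refine ⟨fun P ↦ ?_, fun P Q _ hQ hPQ ↦ ?_⟩
  · refine ((h.1 P).image (PrimeSpectrum.comap g)).subset fun Q hQ ↦ ?_
    obtain ⟨Q', rfl⟩ := hg Q
    exact ⟨Q', hQ, rfl⟩
  · obtain ⟨Q', hQ'⟩ := hg ⟨Q, hQ⟩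
    have e : Q = Q'.asIdeal.comap g := congrArg PrimeSpectrum.asIdeal hQ'.symm
    have e' : P = Q'.asIdeal.comap (g.comp f) := by rw [hPQ, e, Ideal.comap_comap]
    have h2 := h.2 P Q'.asIdeal e'
    rw [Ideal.ResidueField.map_comp_eq f g hPQ e e'] at h2
    set u := Ideal.ResidueField.map P Q f hPQ
    set v := Ideal.ResidueField.map Q Q'.asIdeal g e
    let := u.toAlgebra
    let := (v.comp u).toAlgebra
    have : Module.Finite P.ResidueField Q'.asIdeal.ResidueField := h2
    let w : Q.ResidueField →ₐ[P.ResidueField] Q'.asIdeal.ResidueField :=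
      { v with commutes' := fun _ ↦ rfl }
    exact Module.Finite.of_injective w.toLinearMap v.injective

theorem RingHom.Finite.finiteFibersAndResidueFields {f : A →+* B} (hf : f.Finite) :
    f.FiniteFibersAndResidueFields := by
  algebraize [f]
  refine ⟨fun P ↦ Algebra.QuasiFinite.finite_comap_preimage_singleton (S := B) P,
    fun P Q _ _ h ↦ ?_⟩
  have : Q.LiesOver P := ⟨h⟩
  let := (Ideal.ResidueField.map P Q f h).toAlgebra
  have : IsScalarTower A P.ResidueField Q.ResidueField := .of_algebraMap_eq fun x ↦ by
    rw [RingHom.algebraMap_toAlgebra, Ideal.ResidueField.map_algebraMap]; rfl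
  have : Algebra.QuasiFinite P.ResidueField Q.ResidueField := .of_restrictScalars A _ _
  exact Module.Finite.of_quasiFinite

/-- Distinct elements of a finite set of primes are separated by elements of the ring. -/
theorem Ideal.exists_notMem_forall_mem_of_not_le (s : Finset (PrimeSpectrum B))
    (Q : PrimeSpectrum B) :
    ∃ t : B, t ∉ Q.asIdeal ∧ ∀ Q' ∈ s, ¬ Q' ≤ Q → t ∈ Q'.asIdeal := by
  classical
  have h : ∀ Q' : PrimeSpectrum B, ∃ t : B, t ∉ Q.asIdeal ∧ (¬ Q' ≤ Q → t ∈ Q'.asIdeal) := by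
    intro Q'
    by_cases hle : Q' ≤ Q
    · exact ⟨1, Q.asIdeal.ne_top_iff_one.mp Q.2.ne_top, fun h ↦ absurd hle h⟩
    · obtain ⟨t, ht, ht'⟩ := SetLike.not_le_iff_exists.mp (show ¬ Q'.asIdeal ≤ Q.asIdeal from hle)
      exact ⟨t, ht', fun _ ↦ ht⟩
  choose t ht ht' using h
  refine ⟨∏ Q' ∈ s, t Q', fun hmem ↦ ?_, fun Q' hQ' hle ↦ ?_⟩
  · obtain ⟨Q', -, h⟩ := (Ideal.IsPrime.prod_mem_iff (hp := Q.2)).mp hmem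
    exact ht Q' h
  · exact Ideal.mem_of_dvd _ (Finset.dvd_prod_of_mem t hQ') (ht' Q' hle)

/-- Given `n + 1` such primes, take `t_Q` outside `Q` but in every chosen prime not below `Q`.
Reading a relation modulo each prime, larger primes first, forces every coefficient into `P`. -/
theorem RingHom.FiberRankLE.finite {f : A →+* B} {P : PrimeSpectrum A} {J : Ideal B} {n : ℕ}
    (h : f.FiberRankLE P.asIdeal J n) :
    {Q : PrimeSpectrum B | J ≤ Q.asIdeal ∧ PrimeSpectrum.comap f Q = P}.Finite := by
  classical
  by_contra hinf
  obtain ⟨s, hs, hcard⟩ := (show Set.Infinite _ from hinf).exists_subset_card_eq (n + 1)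
  choose t ht ht' using Ideal.exists_notMem_forall_mem_of_not_le s
  let e : Fin (n + 1) ≃ s := (s.equivFinOfCardEq hcard).symm
  obtain ⟨r, ⟨i, hi⟩, hr⟩ := h fun i ↦ t (e i)
  have mem_iff (Q : s) (a : A) : f a ∈ Q.1.asIdeal ↔ a ∈ P.asIdeal := by
    rw [← (hs Q.2).2]; rfl
  suffices ∀ Q : s, r (e.symm Q) ∈ P.asIdeal from hi (by simpa using this (e i))
  intro Q
  induction Q using WellFoundedGT.induction with
  | ind Q ih =>
    have hQ : ∑ i, f (r i) * t (e i) ∈ Q.1.asIdeal := (hs Q.2).1 hr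
    rw [← Finset.add_sum_erase _ _ (Finset.mem_univ (e.symm Q))] at hQ
    have hrest : ∑ i ∈ Finset.univ.erase (e.symm Q), f (r i) * t (e i) ∈ Q.1.asIdeal := by
      refine Ideal.sum_mem _ fun i hi ↦ ?_
      have hne : e i ≠ Q := fun hh ↦ (Finset.mem_erase.mp hi).1 (by simp [← hh])
      by_cases hle : Q.1 ≤ (e i).1
      · have := ih (e i) (lt_of_le_of_ne hle hne.symm)
        rw [Equiv.symm_apply_apply] at this
        exact Ideal.mul_mem_right _ _ ((mem_iff _ _).mpr this)
      · exact Ideal.mul_mem_left _ _ (ht' _ _ Q.2 hle)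
    have := (Ideal.add_mem_iff_left _ hrest).mp hQ
    rw [Equiv.apply_symm_apply] at this
    exact (mem_iff Q _).mp ((Q.1.2.mem_or_mem this).resolve_right (ht _))

theorem RingHom.FiberRankLE.finite_residueFieldMap {f : A →+* B} {P : Ideal A} {Q : Ideal B}
    [P.IsPrime] [Q.IsPrime] (hPQ : P = Q.comap f) {n : ℕ} (h : f.FiberRankLE P Q n) :
    (Ideal.ResidueField.map P Q f hPQ).Finite := by
  classical
  let := (Ideal.ResidueField.map P Q f hPQ).toAlgebra
  have key (x : Fin (n + 1) → Q.ResidueField) : ¬ LinearIndependent P.ResidueField x := by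
    intro hx
    obtain ⟨⟨b, hb⟩, hint⟩ := IsLocalization.exist_integer_multiples_of_finite
      (nonZeroDivisors (B ⧸ Q)) x
    choose t' ht' using hint
    obtain ⟨t, rfl⟩ : ∃ t : Fin (n + 1) → B, t' = fun i ↦ Ideal.Quotient.mk Q (t i) :=
      ⟨fun i ↦ (t' i).out, by ext i; simp⟩
    obtain ⟨r, ⟨i, hi⟩, hr⟩ := h t
    rw [Fintype.linearIndependent_iff] at hx
    refine hi (Ideal.algebraMap_residueField_eq_zero.mp
      (hx (fun i ↦ algebraMap A P.ResidueField (r i)) ?_ i))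
    have hb0 : algebraMap (B ⧸ Q) Q.ResidueField b ≠ 0 :=
      IsFractionRing.to_map_ne_zero_of_mem_nonZeroDivisors hb
    refine (mul_eq_zero.mp ?_).resolve_left hb0
    rw [← Ideal.algebraMap_residueField_eq_zero, map_sum] at hr
    rw [Finset.mul_sum, ← hr]
    refine Finset.sum_congr rfl fun i _ ↦ ?_
    have := ht' i
    simp only [Algebra.smul_def, Ideal.algebraMap_quotient_residueField_mk] at this ⊢
    have hmap : algebraMap P.ResidueField Q.ResidueField (algebraMap A _ (r i)) =
        algebraMap B _ (f (r i)) := Ideal.ResidueField.map_algebraMap P Q f hPQ _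
    rw [hmap, map_mul, this]
    ring
  have hrank : Module.rank P.ResidueField Q.ResidueField ≤ n := by
    refine rank_le fun s hs ↦ ?_
    by_contra! hlt
    obtain ⟨u, hu, hcard⟩ := Finset.exists_subset_card_eq (Nat.succ_le_of_lt hlt)
    refine key (fun i ↦ ((u.equivFinOfCardEq hcard).symm i).1) ?_
    refine hs.comp (fun i ↦ ⟨((u.equivFinOfCardEq hcard).symm i).1, hu (Subtype.coe_prop _)⟩)
      fun i j hij ↦ ?_
    simpa [Subtype.ext_iff] using hij
  exact Module.rank_lt_aleph0_iff.mp (hrank.trans_lt (Cardinal.natCast_lt_aleph0))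

theorem RingHom.exists_fiberRankLE_of_finite {f : A →+* B} {P : Ideal A} {Q : Ideal B}
    [P.IsPrime] [Q.IsPrime] (hPQ : P = Q.comap f) (h : (Ideal.ResidueField.map P Q f hPQ).Finite) :
    ∃ n, f.FiberRankLE P Q n := by
  let := (Ideal.ResidueField.map P Q f hPQ).toAlgebra
  have : Module.Finite P.ResidueField Q.ResidueField := h
  refine ⟨Module.finrank P.ResidueField Q.ResidueField, fun t ↦ ?_⟩
  have hdep : ¬ LinearIndependent P.ResidueField
      (fun i ↦ algebraMap B Q.ResidueField (t i)) := fun hx ↦ by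
    simpa using hx.fintype_card_le_finrank
  obtain ⟨c, hc, i, hi⟩ := Fintype.not_linearIndependent_iff.mp hdep
  obtain ⟨⟨b, hb⟩, hint⟩ := IsLocalization.exist_integer_multiples_of_finite
    (nonZeroDivisors (A ⧸ P)) c
  choose r' hr' using hint
  obtain ⟨r, rfl⟩ : ∃ r : _ → A, r' = fun i ↦ Ideal.Quotient.mk P (r i) :=
    ⟨fun i ↦ (r' i).out, by ext i; simp⟩
  have hb0 : algebraMap (A ⧸ P) P.ResidueField b ≠ 0 :=
    IsFractionRing.to_map_ne_zero_of_mem_nonZeroDivisors hb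
  simp only [Algebra.smul_def, Ideal.algebraMap_quotient_residueField_mk] at hr' hc
  refine ⟨r, ⟨i, fun hmem ↦ ?_⟩, ?_⟩
  · have := hr' i
    rw [Ideal.algebraMap_residueField_eq_zero.mpr hmem, eq_comm, mul_eq_zero] at this
    exact this.elim hb0 hi
  · rw [← Ideal.algebraMap_residueField_eq_zero, map_sum]
    rw [← mul_zero (algebraMap P.ResidueField Q.ResidueField (algebraMap _ _ b)), ← hc,
      Finset.mul_sum]
    refine Finset.sum_congr rfl fun i _ ↦ ?_
    rw [map_mul, ← Ideal.ResidueField.map_algebraMap P Q f hPQ, hr', map_mul, mul_assoc]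
    rfl

end
-- Locally valuative extensions
section

variable {A B T T' : Type*} [CommRing A] [CommRing B] [CommRing T] [CommRing T']

/-- Locally at `P`, every element of `B` is in the image of `A` or has an inverse there. -/
def RingHom.IsValuativeAt (f : A →+* B) (P : Ideal A) : Prop :=
  ∀ x : B, ∃ s ∉ P, (∃ r, f r = f s * x) ∨ ∃ r, f r * x = f s

/-- Leading coefficient times `x` is integral, hence equals some `c` in `A`. If both it and `c` lie
in `P`, absorbing the top term as `c * x ^ n` lowers the degree without changing the remaining
coefficients modulo `P`. -/
theorem RingHom.exists_mul_mem_range_or_of_eval₂_eq_zero {f : A →+* B} (P : Ideal A)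
    (hf : ∀ x : B, f.IsIntegralElem x → x ∈ f.range) (x : B) (n : ℕ) (F : A[X])
    (hdeg : F.natDegree ≤ n) (hF : F.eval₂ f x = 0) (hcoeff : ∃ i, F.coeff i ∉ P) :
    ∃ s ∉ P, (∃ r, f r = f s * x) ∨ ∃ r, f r * x = f s := by
  induction n generalizing F with
  | zero =>
    obtain ⟨i, hi⟩ := hcoeff
    rw [eq_C_of_natDegree_le_zero hdeg] at hF hi
    obtain rfl : i = 0 := by
      by_contra h0
      rw [coeff_C, if_neg h0] at hi
      exact hi P.zero_mem
    rw [eval₂_C] at hF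
    refine ⟨F.coeff 0, by simpa using hi, .inl ⟨0, by simp [hF]⟩⟩
  | succ n ih =>
    by_cases hlt : F.natDegree ≤ n
    · exact ih F hlt hF hcoeff
    have hn : F.natDegree = n + 1 := by omega
    obtain ⟨c, hc⟩ := hf _ (f.isIntegralElem_leadingCoeff_mul F x hF)
    by_cases hlc : F.leadingCoeff ∉ P
    · exact ⟨_, hlc, .inl ⟨c, hc⟩⟩
    by_cases hcP : c ∉ P
    · exact ⟨c, hcP, .inr ⟨F.leadingCoeff, hc.symm⟩⟩
    push Not at hlc hcP
    obtain ⟨i, hi⟩ := hcoeff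
    have hin : i ≠ n + 1 := fun h ↦ hi (by rwa [h, ← hn])
    refine ih (F.eraseLead + C c * X ^ n) ?_ ?_ ⟨i, ?_⟩
    · refine (natDegree_add_le _ _).trans (max_le ?_ (natDegree_C_mul_X_pow_le _ _))
      exact (eraseLead_natDegree_le _).trans (by omega)
    · rw [← F.eraseLead_add_monomial_natDegree_leadingCoeff] at hF
      rw [eval₂_add, eval₂_monomial, hn] at hF
      rw [eval₂_add, eval₂_mul, eval₂_C, eval₂_pow, eval₂_X, hc, ← hF]
      ring
    · rw [coeff_add, eraseLead_coeff_of_ne _ (by rwa [hn]), coeff_C_mul_X_pow]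
      split_ifs
      · exact fun h ↦ hi ((P.add_mem_iff_left hcP).mp h)
      · simpa using hi

/-- A family of elements of `B`, one of them locally invertible modulo `p`, can be rescaled modulo
`p` to a family in `A` not contained in `P`. -/
theorem RingHom.IsValuativeAt.exists_mul_sub_mem {f : A →+* B} {P : Ideal A} [P.IsPrime]
    (hf : f.IsValuativeAt P) {p : Ideal B}
    (hp : ∀ x ∉ p, ∃ y, ∃ s ∉ P, y * x - f s ∈ p) {ι : Type*} [_root_.Finite ι] (x : ι → B)
    (hx : ∃ i, x i ∉ p) :
    ∃ (y : B) (r : ι → A), (∃ i, r i ∉ P) ∧ ∀ i, y * x i - f (r i) ∈ p := by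
  classical
  cases nonempty_fintype ι
  obtain ⟨i₀, hi₀⟩ := hx
  suffices ∀ s : Finset ι, ∃ (y : B) (r : ι → A), (∃ i ∈ insert i₀ s, r i ∉ P) ∧
      ∀ i ∈ insert i₀ s, y * x i - f (r i) ∈ p by
    simpa using this Finset.univ
  intro s
  induction s using Finset.induction_on with
  | empty =>
    obtain ⟨y, s, hs, h⟩ := hp _ hi₀
    exact ⟨y, fun _ ↦ s, ⟨i₀, by simp, hs⟩, by simpa using h⟩
  | insert j s _ ih =>
    obtain ⟨y, r, ⟨i, his, hi⟩, hr⟩ := ih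
    rw [Finset.insert_comm]
    by_cases hj : j ∈ insert i₀ s
    · rw [Finset.insert_eq_of_mem hj]
      exact ⟨y, r, ⟨i, his, hi⟩, hr⟩
    have hne {k : ι} (hk : k ∈ insert i₀ s) : k ≠ j := fun h ↦ hj (h ▸ hk)
    have hmul (a : A) (b : A) (h : f a * (y * x j) - f b ∈ p) :
        ∀ k ∈ insert j (insert i₀ s),
          (f a * y) * x k - f (Function.update (fun k ↦ a * r k) j b k) ∈ p := by
      intro k hk
      rcases Finset.mem_insert.mp hk with rfl | hk
      · simpa [mul_assoc] using h
      · rw [Function.update_of_ne (hne hk), map_mul, mul_assoc, ← mul_sub]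
        exact p.mul_mem_left _ (hr k hk)
    -- Rescale by `a` or by `b`: the old unit coefficient survives in the first case, and the new
    -- entry `a` is outside `P` in the second.
    obtain ⟨a, ha, ⟨b, hb⟩ | ⟨b, hb⟩⟩ := hf (y * x j)
    · refine ⟨f a * y, _, ⟨i, Finset.mem_insert_of_mem his, ?_⟩, hmul a b (by simp [hb])⟩
      rw [Function.update_of_ne (hne his)]
      exact ‹P.IsPrime›.mul_notMem ha hi
    · refine ⟨f b * y, _, ⟨j, Finset.mem_insert_self _ _, ?_⟩, hmul b a (by simp [hb])⟩
      rwa [Function.update_self]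

/-- There is an ideal of `B` maximal among those not meeting the image of `A \ P`. -/
theorem RingHom.exists_isPrime_maximal_disjoint (f : A →+* B) (hf : Function.Injective f)
    (P : Ideal A) [P.IsPrime] :
    ∃ p : Ideal B, p.IsPrime ∧ (∀ s, f s ∈ p → s ∈ P) ∧
      ∀ x ∉ p, ∃ y, ∃ s ∉ P, y * x - f s ∈ p := by
  have hdisj (J : Ideal B) : Disjoint (J : Set B) (P.primeCompl.map f) ↔ ∀ s, f s ∈ J → s ∈ P := by
    rw [Set.disjoint_right]
    constructor
    · exact fun h s hs ↦ by_contra fun hsP ↦ h ⟨s, hsP, rfl⟩ hs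
    · rintro h _ ⟨s, hs, rfl⟩ hsJ
      exact hs (h s hsJ)
  obtain ⟨p, -, hp⟩ := zorn_le_nonempty₀
    {J : Ideal B | Disjoint (J : Set B) (P.primeCompl.map f)} (fun c hc hchain J hJ ↦
      ⟨sSup c, (hdisj _).mpr fun s hs ↦ by
        obtain ⟨I, hI, hsI⟩ := (Submodule.mem_sSup_of_directed ⟨J, hJ⟩ hchain.directedOn).mp hs
        exact (hdisj I).mp (hc hI) s hsI, fun I hI ↦ le_sSup hI⟩) ⊥
    ((hdisj _).mpr fun s hs ↦ by
      rw [Ideal.mem_bot, map_eq_zero_iff f hf] at hs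
      exact hs ▸ P.zero_mem)
  refine ⟨p, Ideal.isPrime_of_maximally_disjoint p _ hp.prop fun J hJ h ↦
    hJ.not_ge (hp.le_of_ge h hJ.le), (hdisj p).mp hp.prop, fun x hx ↦ ?_⟩
  have hlt : ¬ p ⊔ Ideal.span {x} ≤ p := fun h ↦
    hx (h (Ideal.mem_sup_right (Ideal.mem_span_singleton_self x)))
  have hnot : ¬ ∀ s, f s ∈ p ⊔ Ideal.span {x} → s ∈ P := fun h ↦
    hlt (hp.le_of_ge ((hdisj _).mpr h) le_sup_left)
  push Not at hnot
  obtain ⟨s, hs, hsP⟩ := hnot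
  obtain ⟨a, ha, b, hb, hab⟩ := Submodule.mem_sup.mp hs
  obtain ⟨y, rfl⟩ := Ideal.mem_span_singleton'.mp hb
  refine ⟨y, s, hsP, ?_⟩
  rw [← hab, sub_add_cancel_right]
  exact p.neg_mem ha

/-! ### Descent from the compositum -/

section compositum

variable {f : A →+* B} {g : B →+* T'} {h : A →+* T} {k : T →+* T'}

/-- Every prime of `T` over `P` contains the contraction of a prime of the compositum `T'` of `B`
and `T` over `p`. -/
theorem RingHom.IsValuativeAt.exists_isPrime_comap_le {P : Ideal A} [P.IsPrime]
    (hf : f.IsValuativeAt P) (hcomm : g.comp f = k.comp h) (hk : Function.Injective k)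
    (hgen : ∀ z : T', z ∈ AddSubmonoid.closure {w | ∃ x t, g x * k t = w})
    {p : Ideal B} [p.IsPrime] (hpP : ∀ s, f s ∈ p → s ∈ P)
    (hp : ∀ x ∉ p, ∃ y, ∃ s ∉ P, y * x - f s ∈ p)
    (Q : Ideal T) [Q.IsPrime] (hQ : P = Q.comap h) :
    ∃ Q' : Ideal T', Q'.IsPrime ∧ p = Q'.comap g ∧ Q'.comap k ≤ Q := by
  have hc (a : A) : g (f a) = k (h a) := RingHom.congr_fun hcomm a
  have hmem (a : A) : a ∈ P ↔ h a ∈ Q := by rw [hQ, Ideal.mem_comap]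
  have hadd {z w : T'} (hz : ∃ s ∉ P, ∃ q ∈ Q, k q = k (h s) * z)
      (hw : ∃ s ∉ P, ∃ q ∈ Q, k q = k (h s) * w) :
      ∃ s ∉ P, ∃ q ∈ Q, k q = k (h s) * (z + w) := by
    obtain ⟨s, hs, q, hq, e⟩ := hz
    obtain ⟨s', hs', q', hq', e'⟩ := hw
    refine ⟨s * s', ‹P.IsPrime›.mul_notMem hs hs', h s' * q + h s * q',
      Q.add_mem (Q.mul_mem_left _ hq) (Q.mul_mem_left _ hq'), ?_⟩
    simp only [map_add, map_mul, e, e']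
    ring
  have h1 : (1 : A) ∉ P := P.ne_top_iff_one.mp (‹P.IsPrime›.ne_top)
  have hzero : ∃ s ∉ P, ∃ q ∈ Q, k q = k (h s) * 0 := ⟨1, h1, 0, Q.zero_mem, by simp⟩
  -- Up to a factor outside `P`, elements of `pT'` come from `Q`; hence `pT'` misses `T \ Q`.
  have key (z : T') (hz : z ∈ p.map g) : ∃ s ∉ P, ∃ q ∈ Q, k q = k (h s) * z := by
    rw [Ideal.map, Ideal.span] at hz
    induction hz using Submodule.closure_induction with
    | zero => exact hzero
    | add z w _ _ hz hw => exact hadd hz hw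
    | smul_mem w z hz =>
      obtain ⟨a, ha, rfl⟩ := hz
      rw [smul_eq_mul]
      induction hgen w using AddSubmonoid.closure_induction with
      | zero => simpa using hzero
      | add z w _ _ hz hw => rw [add_mul]; exact hadd hz hw
      | mem w hw =>
        obtain ⟨x, t, rfl⟩ := hw
        have hxa : x * a ∈ p := p.mul_mem_left x ha
        obtain ⟨s, hs, ⟨r, hr⟩ | ⟨r, hr⟩⟩ := hf (x * a)
        · have hrP : r ∈ P := hpP _ (hr ▸ p.mul_mem_left _ hxa)
          refine ⟨s, hs, h r * t, Q.mul_mem_right _ ((hmem r).mp hrP), ?_⟩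
          rw [map_mul, ← hc, ← hc, hr, map_mul, map_mul]
          ring
        · exact absurd (hpP _ (hr ▸ p.mul_mem_left _ hxa)) hs
  obtain ⟨Q', hQ', hle, hdisj⟩ := Ideal.exists_le_prime_disjoint (p.map g) (Q.primeCompl.map k) <| by
    rw [Set.disjoint_right]
    rintro _ ⟨t, ht, rfl⟩ hmap
    obtain ⟨s, hs, q, hq, e⟩ := key _ hmap
    rw [← map_mul] at e
    exact (‹Q.IsPrime›.mul_notMem (fun hh ↦ hs ((hmem s).mpr hh)) ht) (hk e ▸ hq)
  have hQ'Q : Q'.comap k ≤ Q := fun t ht ↦ by_contra fun htQ ↦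
    Set.disjoint_left.mp hdisj ht ⟨t, htQ, rfl⟩
  -- Were `Q' ∩ B` larger than `p`, maximality of `p` would put an element of `A \ P` in `Q' ∩ T ⊆
  -- Q`.
  refine ⟨Q', hQ', le_antisymm (Ideal.map_le_iff_le_comap.mp hle) fun x hx ↦ ?_, hQ'Q⟩
  by_contra hxp
  obtain ⟨y, s, hs, hys⟩ := hp x hxp
  refine hs ((hmem s).mpr (hQ'Q (Ideal.mem_comap.mpr ?_)))
  rw [← hc, ← Ideal.mem_comap, ← sub_sub_cancel (y * x) (f s)]
  exact Ideal.sub_mem _ (Ideal.mul_mem_left _ _ hx) (Ideal.map_le_iff_le_comap.mp hle hys)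

/-- A relation over `B` can be rescaled to have coefficients in `A` modulo `p`, and the error lies
in `Q'`. -/
theorem RingHom.IsValuativeAt.fiberRankLE_comap {P : Ideal A} [P.IsPrime]
    (hf : f.IsValuativeAt P) (hcomm : g.comp f = k.comp h)
    {p : Ideal B} (hp : ∀ x ∉ p, ∃ y, ∃ s ∉ P, y * x - f s ∈ p)
    {Q' : Ideal T'} (hQ' : p = Q'.comap g) {n : ℕ} (hn : g.FiberRankLE p Q' n) :
    h.FiberRankLE P (Q'.comap k) n := by
  intro t
  obtain ⟨x, hx, hsum⟩ := hn fun i ↦ k (t i)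
  obtain ⟨y, r, hr, hyr⟩ := hf.exists_mul_sub_mem hp x hx
  refine ⟨r, hr, ?_⟩
  have hc (a : A) : g (f a) = k (h a) := RingHom.congr_fun hcomm a
  have e : k (∑ i, h (r i) * t i) =
      g y * ∑ i, g (x i) * k (t i) - ∑ i, g (y * x i - f (r i)) * k (t i) := by
    rw [map_sum, Finset.mul_sum, ← Finset.sum_sub_distrib]
    refine Finset.sum_congr rfl fun i _ ↦ ?_
    rw [map_mul, map_sub, map_mul, hc]
    ring
  rw [Ideal.mem_comap, e]
  refine Q'.sub_mem (Q'.mul_mem_left _ hsum) (Q'.sum_mem fun i _ ↦ Q'.mul_mem_right _ ?_)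
  rw [← Ideal.mem_comap, ← hQ']
  exact hyr i

theorem RingHom.FiniteFibersAndResidueFields.of_isValuativeAt (hf : Function.Injective f)
    (hval : ∀ P : Ideal A, P.IsPrime → f.IsValuativeAt P) (hcomm : g.comp f = k.comp h)
    (hk : Function.Injective k)
    (hgen : ∀ z : T', z ∈ AddSubmonoid.closure {w | ∃ x t, g x * k t = w})
    (hg : g.FiniteFibersAndResidueFields) : h.FiniteFibersAndResidueFields := by
  refine ⟨fun P ↦ ?_, fun P Q _ _ hPQ ↦ ?_⟩
  · obtain ⟨p, hpr, hpP, hp⟩ := f.exists_isPrime_maximal_disjoint hf P.asIdeal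
    refine ((hg.1 ⟨p, hpr⟩).biUnion fun Q' hQ' ↦ ?_ : (⋃ Q' ∈ {Q' | PrimeSpectrum.comap g Q' =
      ⟨p, hpr⟩}, {Q : PrimeSpectrum T | Q'.asIdeal.comap k ≤ Q.asIdeal ∧
        PrimeSpectrum.comap h Q = P}).Finite).subset fun Q hQ ↦ ?_
    · have e : p = Q'.asIdeal.comap g := congrArg PrimeSpectrum.asIdeal hQ'.symm
      obtain ⟨n, hn⟩ := RingHom.exists_fiberRankLE_of_finite e (hg.2 _ _ e)
      exact ((hval _ P.2).fiberRankLE_comap hcomm hp e hn).finite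
    · obtain ⟨Q', hpr', e, hle⟩ := (hval _ P.2).exists_isPrime_comap_le hcomm hk hgen hpP hp
        Q.asIdeal (congrArg PrimeSpectrum.asIdeal hQ.symm)
      simp only [Set.mem_iUnion]
      exact ⟨⟨Q', hpr'⟩, PrimeSpectrum.ext e.symm, hle, hQ⟩
  · obtain ⟨p, hpr, hpP, hp⟩ := f.exists_isPrime_maximal_disjoint hf P
    obtain ⟨Q', hpr', e, hle⟩ := (hval P ‹_›).exists_isPrime_comap_le hcomm hk hgen hpP hp Q hPQ
    obtain ⟨n, hn⟩ := RingHom.exists_fiberRankLE_of_finite e (hg.2 _ _ e)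
    refine RingHom.FiberRankLE.finite_residueFieldMap (n := n) hPQ fun t ↦ ?_
    obtain ⟨r, hr, hmem⟩ := (hval P ‹_›).fiberRankLE_comap hcomm hp e hn t
    exact ⟨r, hr, hle hmem⟩

end compositum

end

/-! ### Minimal extensions of subalgebras -/

namespace Subalgebra

variable {R S : Type*} [CommRing R] [CommRing S] [Algebra R S]

theorem restrictScalars_adjoin_le {A B : Subalgebra R S} (h : A ≤ B) {x : S} (hx : x ∈ B) :
    (Algebra.adjoin A {x}).restrictScalars R ≤ B := by
  intro y hy
  rw [mem_restrictScalars] at hy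
  induction hy using Algebra.adjoin_induction with
  | mem y hy => rwa [Set.mem_singleton_iff.mp hy]
  | algebraMap r => exact h r.2
  | add y z _ _ hy hz => exact add_mem hy hz
  | mul y z _ _ hy hz => exact mul_mem hy hz

theorem restrictScalars_adjoin_eq_of_covBy {A B : Subalgebra R S}
    (h : A ⋖ B) {x : S} (hxB : x ∈ B) (hxA : x ∉ A) :
    (Algebra.adjoin A {x}).restrictScalars R = B := by
  have hA : A ≤ (Algebra.adjoin A {x}).restrictScalars R := fun a ha ↦
    (Algebra.adjoin A {x}).algebraMap_mem ⟨a, ha⟩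
  refine (h.eq_or_eq hA (restrictScalars_adjoin_le h.le hxB)).resolve_left fun hh ↦ hxA ?_
  exact hh.le (Algebra.self_mem_adjoin_singleton A x)

theorem eval₂_inclusion_eq_zero_iff {A B : Subalgebra R S} (h : A ≤ B) (p : A[X]) (x : B) :
    p.eval₂ (inclusion h).toRingHom x = 0 ↔ aeval (x : S) p = 0 := by
  have e : ((p.eval₂ (inclusion h).toRingHom x : B) : S) = aeval (x : S) p := by
    rw [aeval_def]
    exact hom_eval₂ p (inclusion h).toRingHom B.val.toRingHom x
  rw [← e, ZeroMemClass.coe_eq_zero]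

theorem isIntegralElem_inclusion_iff {A B : Subalgebra R S} (h : A ≤ B) (x : B) :
    (inclusion h).toRingHom.IsIntegralElem x ↔ IsIntegral A (x : S) := by
  refine exists_congr fun p ↦ and_congr_right fun _ ↦ ?_
  rw [eval₂_inclusion_eq_zero_iff]
  rfl

theorem isIntegral_inclusion_sup {A B T : Subalgebra R S} (hAT : A ≤ T)
    (hB : ∀ x ∈ B, IsIntegral A x) :
    (inclusion (le_sup_right : T ≤ B ⊔ T)).toRingHom.IsIntegral := by
  intro x
  rw [isIntegralElem_inclusion_iff]
  have hle : B ⊔ T ≤ (integralClosure T S).restrictScalars R := by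
    refine sup_le (fun x hx ↦ ?_) fun x hx ↦ (integralClosure T S).algebraMap_mem ⟨x, hx⟩
    obtain ⟨p, hp, hpx⟩ := hB x hx
    refine ⟨p.map (inclusion hAT).toRingHom, hp.map _, ?_⟩
    rw [eval₂_map]
    exact hpx
  exact hle x.2

theorem finite_inclusion_of_covBy {A B : Subalgebra R S} (h : A ⋖ B) {x : S} (hxB : x ∈ B)
    (hxA : x ∉ A) (hx : IsIntegral A x) : (inclusion h.le).toRingHom.Finite := by
  obtain rfl := restrictScalars_adjoin_eq_of_covBy h hxB hxA
  exact Algebra.finite_adjoin_simple_of_isIntegral hx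

/-- If `x ∉ A`, then `x ^ 2 ∉ A` by integral closedness, so minimality gives `A[x ^ 2] = B`. Thus `x
= G(x ^ 2)`, and `X - G(X ^ 2)` has linear coefficient `1`. -/
theorem isValuativeAt_inclusion_of_covBy {A B : Subalgebra R S} (h : A ⋖ B)
    (hint : ∀ x ∈ B, IsIntegral A x → x ∈ A) (P : Ideal A) [P.IsPrime] :
    (inclusion h.le).toRingHom.IsValuativeAt P := by
  have h1 : (1 : A) ∉ P := P.ne_top_iff_one.mp (‹P.IsPrime›.ne_top)
  intro x
  by_cases hxA : (x : S) ∈ A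
  · exact ⟨1, h1, .inl ⟨⟨x, hxA⟩, by rw [map_one, one_mul]; rfl⟩⟩
  have hx2A : (x : S) ^ 2 ∉ A := fun hmem ↦ hxA <| hint x x.2 <|
    IsIntegral.of_pow two_pos (isIntegral_algebraMap (x := (⟨_, hmem⟩ : A)))
  have hmem : (x : S) ∈ Algebra.adjoin A {(x : S) ^ 2} := by
    rw [← mem_restrictScalars R, restrictScalars_adjoin_eq_of_covBy h (pow_mem x.2 2) hx2A]
    exact x.2
  rw [Algebra.adjoin_singleton_eq_range_aeval] at hmem
  obtain ⟨G, hG⟩ := hmem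
  refine RingHom.exists_mul_mem_range_or_of_eval₂_eq_zero P (fun y hy ↦ ?_) x _
    (X - expand A 2 G) le_rfl ?_ ⟨1, ?_⟩
  · exact ⟨⟨y, hint y y.2 ((isIntegralElem_inclusion_iff h.le y).mp hy)⟩, rfl⟩
  · rw [eval₂_inclusion_eq_zero_iff, map_sub, aeval_X, expand_aeval, sub_eq_zero]
    exact hG.symm
  · rw [coeff_sub, coeff_X_one, coeff_expand two_pos, if_neg (by norm_num), sub_zero]
    exact h1

theorem mem_closure_of_mem_sup {B T : Subalgebra R S} (z : (B ⊔ T : Subalgebra R S)) :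
    z ∈ AddSubmonoid.closure {w | ∃ x t,
      (inclusion (le_sup_left : B ≤ B ⊔ T)).toRingHom x *
        (inclusion (le_sup_right : T ≤ B ⊔ T)).toRingHom t = w} := by
  obtain ⟨z, hz⟩ := z
  have hz' : z ∈ toSubmodule B * toSubmodule T := by rw [mul_toSubmodule]; exact hz
  induction hz' using Submodule.mul_induction_on' with
  | mem_mul_mem x hx t ht => exact AddSubmonoid.subset_closure ⟨⟨x, hx⟩, ⟨t, ht⟩, rfl⟩
  | add x hx y hy ihx ihy =>
    rw [mul_toSubmodule] at hx hy
    exact add_mem (ihx hx) (ihy hy)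

/-- Finite fibers and residue extensions descend from `B ⊆ B T` to `A ⊆ T` when `B` is a minimal
extension of `A`. -/
theorem finiteFibersAndResidueFields_of_covBy {A B T : Subalgebra R S} (h : A ⋖ B) (hAT : A ≤ T)
    (hB : (inclusion (le_sup_left : B ≤ B ⊔ T)).toRingHom.FiniteFibersAndResidueFields) :
    (inclusion hAT).toRingHom.FiniteFibersAndResidueFields := by
  have hcomm : (inclusion (le_sup_left : B ≤ B ⊔ T)).toRingHom.comp (inclusion h.le).toRingHom =
    (inclusion (le_sup_right : T ≤ B ⊔ T)).toRingHom.comp (inclusion hAT).toRingHom := rfl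
  by_cases hint : ∀ x ∈ B, IsIntegral A x → x ∈ A
  · exact .of_isValuativeAt (inclusion_injective h.le)
      (fun P _ ↦ isValuativeAt_inclusion_of_covBy h hint P) hcomm
      (inclusion_injective _) mem_closure_of_mem_sup hB
  · push Not at hint
    obtain ⟨x, hxB, hx, hxA⟩ := hint
    have hfin := finite_inclusion_of_covBy h hxB hxA hx
    have hsup := isIntegral_inclusion_sup (B := B) hAT fun y hy ↦
      (isIntegralElem_inclusion_iff h.le ⟨y, hy⟩).mp (hfin.to_isIntegral _)
    refine .of_comp (hcomm ▸ hB.comp hfin.finiteFibersAndResidueFields) ?_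
    exact hsup.comap_surjective (inclusion_injective _)

end Subalgebra

/-! ### Induction along the maximal chain -/

theorem IsMaxChain.exists_covBy {α : Type*} [PartialOrder α] [OrderTop α] {C : Set α}
    (hC : IsMaxChain (· ≤ ·) C) (hfin : C.Finite) {a : α} (ha : a ∈ C) (hne : a ≠ ⊤) :
    ∃ b ∈ C, a ⋖ b := by
  obtain ⟨b, hb⟩ := (hfin.subset (Set.sep_subset C (a < ·))).exists_minimal
    ⟨⊤, hC.top_mem, lt_top_iff_ne_top.mpr hne⟩
  refine ⟨b, hb.prop.1, hb.prop.2, fun c hac hcb ↦ ?_⟩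
  have hle {d : α} (hd : d ∈ C) : d ≤ a ∨ b ≤ d := by
    rcases hC.isChain.total hd ha with h | h
    · exact .inl h
    rcases h.eq_or_lt with rfl | h
    · exact .inl le_rfl
    rcases hC.isChain.total hd hb.prop.1 with h' | h'
    · exact .inr (hb.le_of_le ⟨hd, h⟩ h')
    · exact .inr h'
  have hins : IsChain (· ≤ ·) (insert c C) := hC.isChain.insert fun d hd _ ↦
    (hle hd).elim (fun h ↦ .inr (h.trans hac.le)) fun h ↦ .inl (hcb.le.trans h)
  have hcC : c ∈ C := hC.2 hins (Set.subset_insert c C) ▸ Set.mem_insert c C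
  exact hcb.not_ge (hb.le_of_le ⟨hcC, hac⟩ hcb.le)

theorem IsMaxChain.finiteFibersAndResidueFields_inclusion {R S : Type*} [CommRing R] [CommRing S]
    [Algebra R S] {C : Set (Subalgebra R S)} (hC : IsMaxChain (· ≤ ·) C) (hfin : C.Finite)
    (A : C) (T : Subalgebra R S) (h : A.1 ≤ T) :
    (Subalgebra.inclusion h).toRingHom.FiniteFibersAndResidueFields := by
  have := hfin.to_subtype
  -- `T` must vary, since the step replaces it by `B ⊔ T`.
  induction A using WellFoundedGT.induction generalizing T with
  | ind A ih =>
    by_cases hA : A.1 = ⊤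
    · refine RingHom.Finite.finiteFibersAndResidueFields (.of_surjective _ fun x ↦ ?_)
      exact ⟨⟨x, hA ▸ Algebra.mem_top⟩, rfl⟩
    · obtain ⟨B, hBC, hAB⟩ := hC.exists_covBy hfin A.2 hA
      exact Subalgebra.finiteFibersAndResidueFields_of_covBy hAB h
        (ih ⟨B, hBC⟩ hAB.lt (B ⊔ T) le_sup_left)

theorem corollary6p9 {R S : Type*} [CommRing R] [CommRing S] [Algebra R S]
    (hinj : Function.Injective (algebraMap R S)) (hFMC : IsFMC R S) (T : Subalgebra R S) :
    HasFiniteFibers R T := by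
  obtain ⟨C, hfin, hC⟩ := hFMC
  have hT := hC.finiteFibersAndResidueFields_inclusion hfin ⟨⊥, hC.bot_mem⟩ T bot_le
  have hR : (algebraMap R (⊥ : Subalgebra R S)).Finite := .of_surjective _ fun x ↦ by
    obtain ⟨r, hr⟩ := Algebra.mem_bot.mp x.2
    exact ⟨r, Subtype.ext hr⟩
  exact (hT.comp hR.finiteFibersAndResidueFields).1
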